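/- Theorem (Consistency of SUGAR for soft-thresholding). For $P\ge 1$ and $\lambda>0$ let $\mathrm{ST}(\cdot,\lambda):\mathbb R^P\to\mathbb R^P$ be the soft-thresholding map: $\mathrm{ST}(y,\lambda)_i = y_i+\lambda$ if $y_i\le-\lambda$, $=0$ if $-\lambda<y_i<\lambda$, and $=y_i-\lambda$ otherwise. Let $\sigma>0$ and $z_0\in\mathbb R^N$, and let $\Psi_P\in\mathbb R^{P\times N}$, $P\ge1$, be matrices such that, for all $P>1$, $\Psi_P$ is obtained from $\Psi_{P+1}$ by deleting one row. Put $\mu_0=(\mu_0)_P=\Psi_Pz_0$ and $Y=Y_P=\mu_0+W_P$, where $W=W_P\sim\mathcal N(0,\sigma^2\mathrm{Id}_P)$. (No assumption is made on the joint law of the $W_P$ for different $P$.) For $y\in\mathbb R^P$ and $\epsilon>0$, with $(e_i)$ the canonical basis of $\mathbb R^P$, define \begin{align*} R(\mu_0,\lambda)&=\mathbb E_W\|\mathrm{ST}(Y,\lambda)-\mu_0\|^2,\qquad \mathrm{df}(\mu_0,\lambda)=\sum_{i=1}^P\frac{\mathrm{cov}(Y_i,\mathrm{ST}(Y,\lambda)_i)}{\sigma^2},\\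 \widehat{\mathrm{df}}^{FD}(y,\lambda,\epsilon)&=\frac1\epsilon\sum_{i=1}^P\big(\mathrm{ST}(y+\epsilon e_i,\lambda)-\mathrm{ST}(y,\lambda)\big)_i,\\ \mathrm{SURE}^{FD}(y,\lambda,\epsilon)&=\|\mathrm{ST}(y,\lambda)-y\|^2-\sigma^2P+2\sigma^2\,\widehat{\mathrm{df}}^{FD}(y,\lambda,\epsilon),\\ \mathrm{SUGAR}^{FD}(y,\lambda,\epsilon)&=\nabla_\lambda\,\mathrm{SURE}^{FD}(y,\lambda,\epsilon), \end{align*} where $\nabla_\lambda$ is the weak derivative with respect to $\lambda\in(0,\infty)$. Its value at $\lambda$ is understood as its Lebesgue value: the number $v$ such that the averages of $|g-v|$ over the intervals $(\lambda-r,\lambda+r)$ tend to $0$ as $r\to0^+$, where $g$ is the weak derivative; if such a $v$ exists, $\lambda$ is called a Lebesgue point of $g$. Let $\hat\epsilon(P)>0$ satisfy $\lim_{P\to\infty}\hat\epsilon(P)=0$ and $\lim_{P\to\infty}P^{-1}\hat\epsilon(P)^{-1}=0$, and let $\lambda>0$. Then $R(\mu_0,\cdot)$ and $\mathrm{df}(\mu_0,\cdot)$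 are weakly differentiable on $(0,\infty)$ and $\lambda$ is a Lebesgue point of their weak derivatives. Almost surely, $\lambda\ne|Y_i|$ and $\lambda\neq|Y_i+\hat\epsilon(P)|$ for all $P\ge1$ and $1\le i\le P$. For any $P$ and any realization of $Y=Y_P$ for which this holds for all $1\le i\le P$, $\mathrm{SURE}^{FD}(Y,\cdot,\hat\epsilon(P))$ and $\widehat{\mathrm{df}}^{FD}(Y,\cdot,\hat\epsilon(P))$ are weakly differentiable on $(0,\infty)$ and $\lambda$ is a Lebesgue point of their weak derivatives. Moreover $$\frac1P\Big(\mathrm{SUGAR}^{FD}(Y,\lambda,\hat\epsilon(P))-\nabla_\lambda R(\mu_0,\lambda)\Big)\to0 \quad\text{and}\quad \frac1P\Big(\nabla_\lambda\widehat{\mathrm{df}}^{FD}(Y,\lambda,\hat\epsilon(P))-\nabla_\lambda\mathrm{df}(\mu_0,\lambda)\Big)\to0$$ in probability as $P\to\infty$. -/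

import Mathlib

open MeasureTheory ProbabilityTheory Filter Topology

noncomputable section

/-- `g` is a weak derivative of `f` on the open set `Ω ⊆ ℝ` (test functions in `C_c^1(Ω)`). -/
def IsWeakDerivOn (f g : ℝ → ℝ) (Ω : Set ℝ) : Prop :=
  LocallyIntegrableOn f Ω volume ∧ LocallyIntegrableOn g Ω volume ∧
    ∀ φ : ℝ → ℝ, ContDiff ℝ 1 φ → HasCompactSupport φ → tsupport φ ⊆ Ω →
      ∫ t in Ω, g t * φ t = - ∫ t in Ω, f t * deriv φ t

/-- `t` is a Lebesgue point of `g`, with Lebesgue value `v`: the averages of `|g - v|` over the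
balls shrinking to `t` tend to `0`. Only the a.e.-class of `g` matters, and `v` is unique. -/
def HasLebesgueValue (g : ℝ → ℝ) (t v : ℝ) : Prop :=
  Tendsto (fun r : ℝ => ⨍ s in Metric.ball t r, |g s - v| ∂volume) (𝓝[>] 0) (𝓝 0)

/-- The function `f` of the parameter in `]0, ∞[` is weakly differentiable there, `t` is a Lebesgue
point of its weak gradient, and the value of the weak gradient at this point is `v`. -/
def HasWeakGradAt (f : ℝ → ℝ) (t v : ℝ) : Prop :=
  ∃ g : ℝ → ℝ, IsWeakDerivOn f g (Set.Ioi 0) ∧ HasLebesgueValue g t v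

open Classical in
/-- The value of the weak gradient of `f` at a Lebesgue point `t`
(by convention `0` if `t` is not a Lebesgue point of the weak gradient). -/
def weakGrad (f : ℝ → ℝ) (t : ℝ) : ℝ :=
  if h : ∃ v, HasWeakGradAt f t v then h.choose else 0

/-- Soft-thresholding. -/
def softThreshold {P : ℕ} (y : EuclideanSpace ℝ (Fin P)) (lam : ℝ) : EuclideanSpace ℝ (Fin P) :=
  WithLp.toLp 2 fun i =>
    if y i ≤ -lam then y i + lam else if y i < lam then 0 else y i - lam

/-- The Gaussian noise distribution `N(0, σ² Id_P)`. -/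
def noiseLaw (P : ℕ) (σ : ℝ) : Measure (EuclideanSpace ℝ (Fin P)) :=
  multivariateGaussian 0 (σ ^ 2 • (1 : Matrix (Fin P) (Fin P) ℝ))

/-- The quadratic (prediction) risk `E_W ‖m(μ₀ + W, θ) - μ₀‖²` of an estimator `m`. -/
def risk {P : ℕ} (m : EuclideanSpace ℝ (Fin P) → ℝ → EuclideanSpace ℝ (Fin P)) (σ : ℝ)
    (μ₀ : EuclideanSpace ℝ (Fin P)) (θ : ℝ) : ℝ :=
  ∫ w, ‖m (μ₀ + w) θ - μ₀‖ ^ 2 ∂(noiseLaw P σ)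

/-- The degrees of freedom `∑ᵢ cov(Yᵢ, m(Y, θ)ᵢ) / σ²` of an estimator `m`, `Y = μ₀ + W`. -/
def dof {P : ℕ} (m : EuclideanSpace ℝ (Fin P) → ℝ → EuclideanSpace ℝ (Fin P)) (σ : ℝ)
    (μ₀ : EuclideanSpace ℝ (Fin P)) (θ : ℝ) : ℝ :=
  ∑ i, covariance (fun w => (μ₀ + w) i) (fun w => m (μ₀ + w) θ i) (noiseLaw P σ) / σ ^ 2

/-- The finite-difference estimate of the degrees of freedom, with step `ε`. -/
def dofFD {P : ℕ} (m : EuclideanSpace ℝ (Fin P) → ℝ → EuclideanSpace ℝ (Fin P))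
    (y : EuclideanSpace ℝ (Fin P)) (θ ε : ℝ) : ℝ :=
  1 / ε * ∑ i, (m (y + ε • EuclideanSpace.single i (1 : ℝ)) θ - m y θ) i

/-- The finite-difference Stein unbiased risk estimate, with step `ε`. -/
def sureFD {P : ℕ} (m : EuclideanSpace ℝ (Fin P) → ℝ → EuclideanSpace ℝ (Fin P)) (σ : ℝ)
    (y : EuclideanSpace ℝ (Fin P)) (θ ε : ℝ) : ℝ :=
  ‖m y θ - y‖ ^ 2 - σ ^ 2 * (P : ℝ) + 2 * σ ^ 2 * dofFD m y θ ε

/-- SUGAR: the weak gradient, in the parameter, of the finite-difference SURE. -/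
def sugarFD {P : ℕ} (m : EuclideanSpace ℝ (Fin P) → ℝ → EuclideanSpace ℝ (Fin P)) (σ : ℝ)
    (y : EuclideanSpace ℝ (Fin P)) (θ ε : ℝ) : ℝ :=
  weakGrad (fun t => sureFD m σ y t ε) θ

/-- The mean `(μ₀)_P = Ψ_P z₀` of the `P`-th observation model. -/
def meanObs {N : ℕ} (Ψ : (P : ℕ) → Matrix (Fin P) (Fin N) ℝ) (z₀ : Fin N → ℝ) (P : ℕ) :
    EuclideanSpace ℝ (Fin P) :=
  WithLp.toLp 2 (Matrix.mulVec (Ψ P) z₀)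

end

/-! Everything splits over coordinates. Soft-thresholding is continuous in the threshold `t` and
piecewise affine, with slope `softSlope y t` in {1, 0, -1} jumping only at `t = |y|`. Away from
finitely many thresholds the estimators are therefore classically differentiable, and at such a
`lam` their weak gradients are sums of `softSugar` or `softSlopeFD` evaluated at the `Y_i`. A
Gaussian coordinate almost surely avoids the exceptional values.

On the deterministic side, Stein's identity (`integral_sub_mul_softScalar`) turns the covariance of
`Y_i` with its thresholding into `v * gaussianTail`. Each coordinate of the degrees of freedom is
thus a tail probability T(t), and each coordinate of the risk has derivative 2tT + 2vT'.

The finite difference of the slope is -1/ε on two windows of length ε adjacent to ±t (summed where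
they overlap). Its mean is within O(ε) of T', because the Gaussian density is Lipschitz; its second
moment is O(1/ε), because the density is bounded. Both constants are independent of the mean, so
nothing is needed about `μ₀`. By independence the average of `P` coordinates has variance O(1/P +
1/(Pε)), and Chebyshev's inequality concludes. Only the law of each `W P` enters, never a joint law.
-/

open scoped NNReal

/-! ### Weak derivatives and Lebesgue values -/

/-- The fundamental theorem of calculus tolerates a countable exceptional set for continuous
functions. It is applied to `f * φ` on a compact interval around the support of `φ`, where the
boundary terms vanish. -/
theorem isWeakDerivOn_of_hasDerivAt_off_countable {f g : ℝ → ℝ} {s : Set ℝ} (hs : s.Countable)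
    (hf : ContinuousOn f (Set.Ioi 0)) (hd : ∀ t ∈ Set.Ioi (0 : ℝ) \ s, HasDerivAt f (g t) t)
    (hg : LocallyIntegrableOn g (Set.Ioi 0) volume) : IsWeakDerivOn f g (Set.Ioi 0) := by
  refine ⟨hf.locallyIntegrableOn measurableSet_Ioi, hg, fun φ hφ hc hsupp => ?_⟩
  have hφd : Continuous (deriv φ) := hφ.continuous_deriv le_rfl
  obtain ⟨a, b, ha, hab, hsub⟩ : ∃ a b : ℝ, 0 < a ∧ a ≤ b ∧ tsupport φ ⊆ Set.Ioo a b := by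
    have hK : IsCompact (tsupport φ) := hc
    rcases (tsupport φ).eq_empty_or_nonempty with he | hne
    · exact ⟨1, 1, one_pos, le_rfl, by simp [he]⟩
    · obtain ⟨x, hx, hxm⟩ := hK.exists_isLeast hne
      obtain ⟨y, hy, hym⟩ := hK.exists_isGreatest hne
      have hx0 : 0 < x := hsupp hx
      have := hym hx
      refine ⟨x / 2, y + 1, by linarith, by linarith, fun z hz => ?_⟩
      have h1 := hxm hz
      have h2 := hym hz
      exact ⟨by linarith, by linarith⟩
  have hsub0 : Set.Icc a b ⊆ Set.Ioi 0 := fun x hx => ha.trans_le hx.1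
  have hφ0 : ∀ t ∉ Set.Ioc a b, φ t = 0 := fun t ht =>
    image_eq_zero_of_notMem_tsupport fun h => ht ⟨(hsub h).1, (hsub h).2.le⟩
  have hdφ0 : ∀ t ∉ Set.Ioc a b, deriv φ t = 0 := fun t ht =>
    image_eq_zero_of_notMem_tsupport fun h =>
      ht ⟨(hsub (tsupport_deriv_subset h)).1, (hsub (tsupport_deriv_subset h)).2.le⟩
  have key : ∀ h : ℝ → ℝ, (∀ t ∉ Set.Ioc a b, h t = 0) →
      ∫ t in Set.Ioi (0 : ℝ), h t = ∫ t in a..b, h t := fun h hh => by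
    rw [intervalIntegral.integral_of_le hab]
    exact (setIntegral_eq_of_subset_of_forall_sdiff_eq_zero measurableSet_Ioi
      (fun x hx => ha.trans hx.1) fun x hx => hh x hx.2)
  have hgi : IntegrableOn g (Set.Icc a b) := hg.integrableOn_compact_subset hsub0 isCompact_Icc
  have hgφ : IntervalIntegrable (fun t => g t * φ t) volume a b := by
    rw [intervalIntegrable_iff_integrableOn_Icc_of_le hab]
    exact hgi.mul_continuousOn hφ.continuous.continuousOn isCompact_Icc
  have hfφ : IntervalIntegrable (fun t => f t * deriv φ t) volume a b := by
    rw [intervalIntegrable_iff_integrableOn_Icc_of_le hab]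
    exact ((hf.mono hsub0).mul hφd.continuousOn).integrableOn_Icc
  rw [key _ fun t ht => by simp [hφ0 t ht], key _ fun t ht => by simp [hdφ0 t ht],
    eq_neg_iff_add_eq_zero, ← intervalIntegral.integral_add hgφ hfφ]
  rw [integral_eq_of_hasDerivAt_off_countable_of_le (fun t => f t * φ t) _ hab hs
    ((hf.mono hsub0).mul hφ.continuous.continuousOn) ?_ (hgφ.add hfφ)]
  · have h1 : φ a = 0 := hφ0 a fun h => h.1.false
    have h2 : φ b = 0 := image_eq_zero_of_notMem_tsupport fun h => (hsub h).2.false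
    simp [h1, h2]
  · intro x hx
    exact (hd x ⟨ha.trans hx.1.1, hx.2⟩).mul
      ((hφ.differentiable one_ne_zero) x).hasDerivAt

theorem hasLebesgueValue_of_continuousAt {g : ℝ → ℝ} {t : ℝ} (hg : ContinuousAt g t) :
    HasLebesgueValue g t (g t) := by
  rw [HasLebesgueValue, Metric.tendsto_nhds]
  intro δ hδ
  obtain ⟨η, hη, h⟩ := Metric.continuousAt_iff.1 hg (δ / 2) (half_pos hδ)
  filter_upwards [Ioo_mem_nhdsGT hη] with r hr
  have hb : ∀ s ∈ Metric.ball t r, ‖|g s - g t|‖ ≤ δ / 2 := fun s hs => by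
    have := h (Metric.ball_subset_ball hr.2.le hs)
    rw [Real.dist_eq] at this
    simpa using this.le
  rw [dist_zero_right, setAverage_eq, norm_smul]
  have hv : 0 < volume.real (Metric.ball t r) := by
    rw [Real.volume_real_ball hr.1.le]; linarith [hr.1]
  have := norm_setIntegral_le_of_norm_le_const (μ := volume) (s := Metric.ball t r)
    measure_ball_lt_top hb
  rw [norm_inv, Real.norm_of_nonneg hv.le]
  calc _ ≤ (volume.real (Metric.ball t r))⁻¹ * (δ / 2 * volume.real (Metric.ball t r)) := by gcongr
    _ = δ / 2 := by field_simp
    _ < δ := half_lt_self hδ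

theorem hasWeakGradAt_of_hasDerivAt_off_countable {f g : ℝ → ℝ} {s : Set ℝ} {t : ℝ}
    (hs : s.Countable)
    (hf : ContinuousOn f (Set.Ioi 0)) (hd : ∀ t ∈ Set.Ioi (0 : ℝ) \ s, HasDerivAt f (g t) t)
    (hg : LocallyIntegrableOn g (Set.Ioi 0) volume) (ht : ContinuousAt g t) :
    HasWeakGradAt f t (g t) :=
  ⟨g, isWeakDerivOn_of_hasDerivAt_off_countable hs hf hd hg, hasLebesgueValue_of_continuousAt ht⟩

theorem IsWeakDerivOn.ae_eq {f g₁ g₂ : ℝ → ℝ} {U : Set ℝ} (hU : IsOpen U)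
    (h₁ : IsWeakDerivOn f g₁ U) (h₂ : IsWeakDerivOn f g₂ U) :
    ∀ᵐ x, x ∈ U → g₁ x = g₂ x := by
  have := hU.ae_eq_zero_of_integral_contDiff_smul_eq_zero (μ := volume)
    (f := fun x => g₁ x - g₂ x) (h₁.2.1.sub h₂.2.1) ?_
  · filter_upwards [this] with x hx hxU using sub_eq_zero.1 (hx hxU)
  intro φ hφ hc hsupp
  have hφ1 : ContDiff ℝ 1 φ := hφ.of_le (by exact_mod_cast le_top)
  have hint : ∀ g : ℝ → ℝ, LocallyIntegrableOn g U volume →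
      Integrable (fun x => g x * φ x) volume := fun g hg => by
    have h := (hg.integrableOn_compact_subset hsupp hc).mul_continuousOn
      hφ.continuous.continuousOn hc
    refine (integrableOn_iff_integrable_of_support_subset ?_).1 h
    exact (Function.support_mul_subset_right _ _).trans (subset_tsupport φ)
  have hset : ∀ g : ℝ → ℝ, ∫ x in U, g x * φ x = ∫ x, g x * φ x := fun g =>
    setIntegral_eq_integral_of_forall_compl_eq_zero fun x hx => by
      rw [image_eq_zero_of_notMem_tsupport fun h => hx (hsupp h), mul_zero]
  have e1 := h₁.2.2 φ hφ1 hc hsupp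
  have e2 := h₂.2.2 φ hφ1 hc hsupp
  rw [hset] at e1 e2
  simp only [smul_eq_mul, mul_comm (φ _), sub_mul]
  rw [integral_sub (hint _ h₁.2.1) (hint _ h₂.2.1), e1, e2, sub_self]

/-- Two weak derivatives agree almost everywhere, so averaging |v₁ - v₂| ≤ |g - v₁| + |g - v₂| over
shrinking balls forces equality. This makes the choice in `weakGrad` harmless; `0 < t` keeps small
balls inside the half-line. -/
theorem HasWeakGradAt.unique {f : ℝ → ℝ} {t v₁ v₂ : ℝ} (ht : 0 < t)
    (h₁ : HasWeakGradAt f t v₁) (h₂ : HasWeakGradAt f t v₂) : v₁ = v₂ := by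
  obtain ⟨g₁, hw₁, hl₁⟩ := h₁
  obtain ⟨g₂, hw₂, hl₂⟩ := h₂
  have hae := hw₁.ae_eq isOpen_Ioi hw₂
  have hlim := hl₁.add hl₂
  rw [add_zero] at hlim
  have hle : |v₁ - v₂| ≤ 0 := by
    refine ge_of_tendsto hlim ?_
    filter_upwards [Ioo_mem_nhdsGT ht] with r hr
    have hv : 0 < volume.real (Metric.ball t r) := by
      rw [Real.volume_real_ball hr.1.le]; linarith [hr.1]
    have hsub : Metric.closedBall t r ⊆ Set.Ioi 0 := fun x hx => by
      rw [Real.closedBall_eq_Icc] at hx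
      have := hx.1
      have := hr.2
      simp only [Set.mem_Ioi]; linarith
    have hi : ∀ g : ℝ → ℝ, LocallyIntegrableOn g (Set.Ioi 0) volume → ∀ v : ℝ,
        IntegrableOn (fun s => |g s - v|) (Metric.ball t r) volume := fun g hg v =>
      (((hg.integrableOn_compact_subset hsub (isCompact_closedBall t r)).mono_set
        Metric.ball_subset_closedBall).sub
          (integrableOn_const measure_ball_lt_top.ne)).abs
    rw [setAverage_eq, setAverage_eq, ← smul_add,
      ← integral_add (hi _ hw₁.2.1 _) (hi _ hw₂.2.1 _), smul_eq_mul, ← div_eq_inv_mul,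
      le_div_iff₀ hv]
    have hc : |v₁ - v₂| * volume.real (Metric.ball t r) =
        ∫ _ in Metric.ball t r, |v₁ - v₂| := by
      rw [setIntegral_const, smul_eq_mul, mul_comm]
    rw [hc]
    refine setIntegral_mono_on_ae (integrableOn_const measure_ball_lt_top.ne)
      ((hi _ hw₁.2.1 _).add (hi _ hw₂.2.1 _)) measurableSet_ball ?_
    filter_upwards [hae] with x hx hxb
    rw [hx (hsub (Metric.ball_subset_closedBall hxb)), abs_sub_comm (g₂ x) v₁]
    exact abs_sub_le _ _ _
  exact sub_eq_zero.1 (abs_nonpos_iff.1 hle)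

theorem HasWeakGradAt.weakGrad_eq {f : ℝ → ℝ} {t v : ℝ} (ht : 0 < t)
    (h : HasWeakGradAt f t v) : weakGrad f t = v := by
  have hex : ∃ v, HasWeakGradAt f t v := ⟨v, h⟩
  rw [weakGrad, dif_pos hex]
  exact hex.choose_spec.unique ht h

theorem HasWeakGradAt.hasWeakGradAt_weakGrad {f : ℝ → ℝ} {t v : ℝ} (ht : 0 < t)
    (h : HasWeakGradAt f t v) : HasWeakGradAt f t (weakGrad f t) := by
  rwa [h.weakGrad_eq ht]

/-! ### Scalar soft-thresholding and its slope in the threshold -/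

/-- Soft-thresholding of a real number. -/
noncomputable def softScalar (y t : ℝ) : ℝ :=
  if y ≤ -t then y + t else if y < t then 0 else y - t

/-- The derivative of soft-thresholding in the threshold. -/
noncomputable def softSlope (y t : ℝ) : ℝ :=
  if y ≤ -t then 1 else if y < t then 0 else -1

theorem softThreshold_apply {P : ℕ} (y : EuclideanSpace ℝ (Fin P)) (t : ℝ) (i : Fin P) :
    softThreshold y t i = softScalar (y i) t := rfl

theorem softScalar_eq_max_add_min {y t : ℝ} (ht : 0 ≤ t) :
    softScalar y t = max (y - t) 0 + min (y + t) 0 := by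
  unfold softScalar
  split_ifs with h1 h2
  · rw [max_eq_right (by linarith), min_eq_left (by linarith), zero_add]
  · rw [max_eq_right (by linarith), min_eq_right (by linarith), zero_add]
  · rw [max_eq_left (by linarith), min_eq_right (by linarith), add_zero]

theorem continuousOn_softScalar (y : ℝ) : ContinuousOn (softScalar y) (Set.Ioi 0) := by
  have h : Continuous fun t => max (y - t) 0 + min (y + t) 0 := by fun_prop
  exact h.continuousOn.congr fun t ht => softScalar_eq_max_add_min (le_of_lt ht)

theorem softSlope_eventuallyEq {y t : ℝ} (ht : 0 < t) (hy : t ≠ |y|) :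
    softSlope y =ᶠ[𝓝 t] fun _ => softSlope y t := by
  rcases lt_or_gt_of_ne hy with h | h
  · rcases le_total 0 y with h0 | h0
    · rw [abs_of_nonneg h0] at h
      filter_upwards [Ioo_mem_nhds ht h] with s hs
      have := hs.1
      have := hs.2
      simp only [softSlope]
      rw [if_neg (by linarith), if_neg (by linarith), if_neg (by linarith), if_neg (by linarith)]
    · rw [abs_of_nonpos h0] at h
      filter_upwards [Iio_mem_nhds h] with s hs
      have : s < -y := hs
      simp only [softSlope]
      rw [if_pos (by linarith), if_pos (by linarith)]
  · filter_upwards [Ioi_mem_nhds h] with s hs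
    have h1 := abs_lt.1 (Set.mem_Ioi.1 hs)
    have h2 := abs_lt.1 h
    simp only [softSlope]
    rw [if_neg (by linarith), if_pos (by linarith), if_neg (by linarith), if_pos (by linarith)]

theorem continuousAt_softSlope {y t : ℝ} (ht : 0 < t) (hy : t ≠ |y|) :
    ContinuousAt (softSlope y) t :=
  continuousAt_const.congr (softSlope_eventuallyEq ht hy).symm

theorem hasDerivAt_softScalar {y t : ℝ} (ht : 0 < t) (hy : t ≠ |y|) :
    HasDerivAt (softScalar y) (softSlope y t) t := by
  have h : softScalar y =ᶠ[𝓝 t]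
      fun s => softScalar y t + softSlope y t * (s - t) := by
    rcases lt_or_gt_of_ne hy with h | h
    · rcases le_total 0 y with h0 | h0
      · rw [abs_of_nonneg h0] at h
        filter_upwards [Ioo_mem_nhds ht h] with s hs
        have := hs.1
        have := hs.2
        simp only [softSlope, softScalar]
        rw [if_neg (by linarith), if_neg (by linarith), if_neg (by linarith), if_neg (by linarith),
          if_neg (by linarith), if_neg (by linarith)]
        ring
      · rw [abs_of_nonpos h0] at h
        filter_upwards [Iio_mem_nhds h] with s hs
        have : s < -y := hs
        simp only [softSlope, softScalar]
        rw [if_pos (by linarith), if_pos (by linarith), if_pos (by linarith)]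
        ring
    · filter_upwards [Ioi_mem_nhds h] with s hs
      have h1 := abs_lt.1 (Set.mem_Ioi.1 hs)
      have h2 := abs_lt.1 h
      simp only [softSlope, softScalar]
      rw [if_neg (by linarith), if_pos (by linarith), if_neg (by linarith), if_pos (by linarith),
        if_neg (by linarith), if_pos (by linarith)]
      ring
  refine HasDerivAt.congr_of_eventuallyEq ?_ h
  simpa only [id_eq, mul_one] using
    (((hasDerivAt_id t).sub_const t).const_mul (softSlope y t)).const_add (softScalar y t)

theorem abs_softSlope_le_one (y t : ℝ) : |softSlope y t| ≤ 1 := by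
  unfold softSlope
  split_ifs <;> simp

@[fun_prop]
theorem measurable_softSlope_threshold (y : ℝ) : Measurable (softSlope y) :=
  Measurable.ite (measurableSet_le measurable_const measurable_neg) measurable_const
    (Measurable.ite (measurableSet_lt measurable_const measurable_id) measurable_const
      measurable_const)

@[fun_prop]
theorem measurable_softSlope (t : ℝ) : Measurable fun y => softSlope y t :=
  Measurable.ite (measurableSet_le measurable_id measurable_const) measurable_const
    (Measurable.ite (measurableSet_lt measurable_id measurable_const) measurable_const
      measurable_const)

@[fun_prop]
theorem measurable_softScalar (t : ℝ) : Measurable fun y => softScalar y t :=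
  Measurable.ite (measurableSet_le measurable_id measurable_const) (by fun_prop)
    (Measurable.ite (measurableSet_lt measurable_id measurable_const) measurable_const
      (by fun_prop))

theorem abs_softScalar_sub_le {y t : ℝ} (ht : 0 < t) : |softScalar y t - y| ≤ t := by
  unfold softScalar
  rw [abs_le]
  split_ifs with h1 h2 <;> constructor <;> linarith

/-- Where the slope is nonzero, the residual is exactly `t` times the slope. Hence the data-fidelity
term has derivative `2 * t * softSlope y t ^ 2`. -/
theorem softScalar_sub_mul_softSlope {y t : ℝ} (ht : 0 < t) :
    (softScalar y t - y) * softSlope y t = t * softSlope y t ^ 2 := by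
  unfold softScalar softSlope
  split_ifs <;> ring

theorem locallyIntegrable_of_abs_le {g h : ℝ → ℝ} (hg : Measurable g) (hh : Continuous h)
    (hle : ∀ t, |g t| ≤ h t) : LocallyIntegrable g volume :=
  hh.locallyIntegrable.mono hg.aestronglyMeasurable
    (ae_of_all _ fun t => by simpa using (hle t).trans (le_abs_self _))

theorem locallyIntegrable_softSlope (y : ℝ) : LocallyIntegrable (softSlope y) volume :=
  locallyIntegrable_of_abs_le (by fun_prop) continuous_const (abs_softSlope_le_one y)

theorem softSlope_sq_le_one (y t : ℝ) : softSlope y t ^ 2 ≤ 1 := by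
  rw [← sq_abs]
  exact pow_le_one₀ (abs_nonneg _) (abs_softSlope_le_one y t)

theorem locallyIntegrable_mul_softSlope_sq (y : ℝ) :
    LocallyIntegrable (fun t => 2 * t * softSlope y t ^ 2) volume := by
  refine locallyIntegrable_of_abs_le (h := fun t => 2 * |t|) (by fun_prop) (by fun_prop) fun t => ?_
  rw [abs_mul, abs_mul, abs_two, abs_of_nonneg (sq_nonneg (softSlope y t))]
  exact mul_le_of_le_one_right (by positivity) (softSlope_sq_le_one y t)

theorem continuousAt_mul_softSlope_sq {y t : ℝ} (ht : 0 < t) (hy : t ≠ |y|) :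
    ContinuousAt (fun t => 2 * t * softSlope y t ^ 2) t := by
  have := continuousAt_softSlope ht hy
  fun_prop

theorem hasDerivAt_softScalar_sub_sq {y t : ℝ} (ht : 0 < t) (hy : t ≠ |y|) :
    HasDerivAt (fun t => (softScalar y t - y) ^ 2) (2 * t * softSlope y t ^ 2) t := by
  refine (((hasDerivAt_softScalar ht hy).sub_const y).fun_pow 2).congr_deriv ?_
  have := softScalar_sub_mul_softSlope (y := y) ht
  simp only [Nat.cast_ofNat, Nat.add_one_sub_one, pow_one]
  linear_combination 2 * this

theorem softSlope_eq_indicator {t : ℝ} (ht : 0 < t) (y : ℝ) :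
    softSlope y t = (Set.Iic (-t)).indicator 1 y - (Set.Ici t).indicator 1 y := by
  simp only [softSlope, Set.indicator, Set.mem_Iic, Set.mem_Ici, Pi.one_apply]
  split_ifs <;> linarith

theorem softSlope_sq_eq_indicator {t : ℝ} (ht : 0 < t) (y : ℝ) :
    softSlope y t ^ 2 = (Set.Iic (-t)).indicator 1 y + (Set.Ici t).indicator 1 y := by
  simp only [softSlope, Set.indicator, Set.mem_Iic, Set.mem_Ici, Pi.one_apply]
  split_ifs <;> linarith

theorem softScalar_sub_sq_eq {t : ℝ} (ht : 0 < t) (y : ℝ) :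
    (softScalar y t - y) ^ 2 =
      t ^ 2 * softSlope y t ^ 2 + (Set.Ioo (-t) t).indicator (fun y => y ^ 2) y := by
  simp only [softSlope, softScalar, Set.indicator, Set.mem_Ioo]
  split_ifs <;> first | (exfalso; grind) | ring

/-- Moving `y` up by `ε` changes the slope only when a threshold is crossed, and each crossing
lowers it by 1. The windows may overlap, so `ε` need not be small. -/
theorem softSlope_shift_sub {t ε : ℝ} (ht : 0 < t) (hε : 0 < ε) (y : ℝ) :
    softSlope (y + ε) t - softSlope y t =
      -((Set.Ioc (-t - ε) (-t)).indicator 1 y + (Set.Ico (t - ε) t).indicator 1 y) := by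
  rw [softSlope_eq_indicator ht, softSlope_eq_indicator ht]
  have h1 : (Set.Iic (-t)).indicator (1 : ℝ → ℝ) y - (Set.Iic (-t)).indicator 1 (y + ε) =
      (Set.Ioc (-t - ε) (-t)).indicator 1 y := by
    simp only [Set.indicator, Set.mem_Iic, Set.mem_Ioc, Pi.one_apply]
    split_ifs <;> first | (exfalso; grind) | simp
  have h2 : (Set.Ici t).indicator (1 : ℝ → ℝ) (y + ε) - (Set.Ici t).indicator 1 y =
      (Set.Ico (t - ε) t).indicator 1 y := by
    simp only [Set.indicator, Set.mem_Ici, Set.mem_Ico, Pi.one_apply]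
    split_ifs <;> first | (exfalso; grind) | simp
  linarith

/-! ### Finite difference of the slope -/

/-- The weak gradient in the threshold of the finite-difference degrees of freedom, per
coordinate. -/
noncomputable def softSlopeFD (ε t y : ℝ) : ℝ := (softSlope (y + ε) t - softSlope y t) / ε

@[fun_prop]
theorem measurable_softSlopeFD (ε t : ℝ) : Measurable (softSlopeFD ε t) := by
  have : Measurable fun y => softSlope (y + ε) t :=
    (measurable_softSlope t).comp (measurable_id.add_const ε)
  unfold softSlopeFD
  fun_prop

theorem abs_softSlopeFD_le {ε : ℝ} (hε : 0 < ε) (t y : ℝ) : |softSlopeFD ε t y| ≤ 2 / ε := by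
  rw [softSlopeFD, abs_div, abs_of_pos hε]
  gcongr
  refine (abs_sub _ _).trans ?_
  linarith [abs_softSlope_le_one (y + ε) t, abs_softSlope_le_one y t]

theorem softSlopeFD_eq {t ε : ℝ} (ht : 0 < t) (hε : 0 < ε) (y : ℝ) :
    softSlopeFD ε t y =
      -((Set.Ioc (-t - ε) (-t)).indicator 1 y + (Set.Ico (t - ε) t).indicator 1 y) / ε := by
  rw [softSlopeFD, softSlope_shift_sub ht hε]

theorem softSlopeFD_nonpos {t ε : ℝ} (ht : 0 < t) (hε : 0 < ε) (y : ℝ) :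
    softSlopeFD ε t y ≤ 0 := by
  rw [softSlopeFD_eq ht hε, neg_div, neg_nonpos]
  have h : ∀ s : Set ℝ, 0 ≤ s.indicator (1 : ℝ → ℝ) y := fun s =>
    Set.indicator_nonneg (fun _ _ => zero_le_one) y
  have := h (Set.Ioc (-t - ε) (-t))
  have := h (Set.Ico (t - ε) t)
  positivity

/-- The values lie in [-2/ε, 0]. Bounding the square by the first power is what yields a second
moment of order 1/ε instead of 1/ε². -/
theorem softSlopeFD_sq_le {t ε : ℝ} (ht : 0 < t) (hε : 0 < ε) (y : ℝ) :
    softSlopeFD ε t y ^ 2 ≤ 2 / ε * -softSlopeFD ε t y := by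
  have h := softSlopeFD_nonpos ht hε y
  have h' := abs_softSlopeFD_le hε t y
  rw [abs_of_nonpos h] at h'
  nlinarith

/-! ### Gaussian density: uniform bounds and integration -/

theorem hasDerivAt_gaussianPDFReal (μ : ℝ) (v : ℝ≥0) (x : ℝ) :
    HasDerivAt (gaussianPDFReal μ v) (-((x - μ) / v * gaussianPDFReal μ v x)) x := by
  have h1 : HasDerivAt (fun x : ℝ => -(x - μ) ^ 2 / (2 * v)) (-((x - μ) / v)) x := by
    refine (((((hasDerivAt_id x).sub_const μ).fun_pow 2).fun_neg).div_const (2 * (v : ℝ))).congr_deriv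
      ?_
    simp only [id_eq, Nat.cast_ofNat, Nat.add_one_sub_one, pow_one, mul_one]
    rw [neg_div, mul_div_mul_left _ _ two_ne_zero]
  rw [gaussianPDFReal_def]
  refine (h1.exp.const_mul (√(2 * Real.pi * v))⁻¹).congr_deriv ?_
  ring

@[fun_prop]
theorem continuous_gaussianPDFReal (μ : ℝ) (v : ℝ≥0) : Continuous (gaussianPDFReal μ v) :=
  continuous_iff_continuousAt.2 fun x => (hasDerivAt_gaussianPDFReal μ v x).continuousAt

theorem gaussianPDFReal_le (μ : ℝ) (v : ℝ≥0) (x : ℝ) :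
    gaussianPDFReal μ v x ≤ (√(2 * Real.pi * v))⁻¹ := by
  rw [gaussianPDFReal_def]
  refine mul_le_of_le_one_right (by positivity) (Real.exp_le_one_iff.2 ?_)
  exact div_nonpos_of_nonpos_of_nonneg (neg_nonpos.2 (sq_nonneg _)) (by positivity)

/-- The derivative of the density depends only on u = z - μ, and |u| exp(-u²/(2v)) is bounded since
exp(x) ≥ 1 + x. The constant is therefore independent of the mean. -/
theorem exists_abs_gaussianPDFReal_sub_le {v : ℝ≥0} (hv : v ≠ 0) :
    ∃ L : ℝ, 0 ≤ L ∧ ∀ μ x y : ℝ,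
      |gaussianPDFReal μ v y - gaussianPDFReal μ v x| ≤ L * |y - x| := by
  have hv0 : (0 : ℝ) < v := NNReal.coe_pos.2 (pos_iff_ne_zero.2 hv)
  refine ⟨(1 + 2 * v) / v * (√(2 * Real.pi * v))⁻¹, by positivity, fun μ x y => ?_⟩
  refine Convex.norm_image_sub_le_of_norm_hasDerivWithin_le (s := Set.univ)
    (fun z _ => (hasDerivAt_gaussianPDFReal μ v z).hasDerivWithinAt) (fun z _ => ?_) convex_univ
    (Set.mem_univ x) (Set.mem_univ y)
  set u := z - μ with hu
  have h1 : 1 + u ^ 2 / (2 * v) ≤ Real.exp (u ^ 2 / (2 * v)) := by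
    rw [add_comm]; exact Real.add_one_le_exp _
  have h2 : |u| ≤ (1 + 2 * v) * (1 + u ^ 2 / (2 * v)) := by
    have : (1 + 2 * v) * (1 + u ^ 2 / (2 * v)) = 1 + 2 * v + u ^ 2 / (2 * v) + u ^ 2 := by
      field_simp
      ring
    rw [this]
    have : 0 ≤ u ^ 2 / (2 * v) := by positivity
    nlinarith [sq_nonneg (|u| - 1), sq_abs u]
  have h3 : |u| * Real.exp (-u ^ 2 / (2 * v)) ≤ 1 + 2 * v := by
    rw [neg_div, Real.exp_neg, ← div_eq_mul_inv, div_le_iff₀ (Real.exp_pos _)]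
    exact h2.trans (by gcongr)
  rw [norm_neg, norm_mul, norm_div, Real.norm_of_nonneg (gaussianPDFReal_nonneg μ v z),
    Real.norm_of_nonneg hv0.le, Real.norm_eq_abs, gaussianPDFReal_def]
  calc |u| / v * ((√(2 * Real.pi * v))⁻¹ * Real.exp (-u ^ 2 / (2 * v)))
      = |u| * Real.exp (-u ^ 2 / (2 * v)) / v * (√(2 * Real.pi * v))⁻¹ := by ring
    _ ≤ _ := by gcongr

theorem setIntegral_gaussianReal {v : ℝ≥0} (hv : v ≠ 0) (μ : ℝ) {s : Set ℝ} (hs : MeasurableSet s)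
    (f : ℝ → ℝ) :
    ∫ x in s, f x ∂(gaussianReal μ v) = ∫ x in s, gaussianPDFReal μ v x * f x := by
  rw [← integral_indicator hs, integral_gaussianReal_eq_integral_smul hv, ← integral_indicator hs]
  congr 1 with x
  by_cases hx : x ∈ s <;> simp [hx]

theorem integrable_gaussianReal_iff {v : ℝ≥0} (hv : v ≠ 0) (μ : ℝ) (f : ℝ → ℝ) :
    Integrable f (gaussianReal μ v) ↔ Integrable (fun x => gaussianPDFReal μ v x * f x) := by
  rw [gaussianReal_of_var_ne_zero μ hv, integrable_withDensity_iff_integrable_smul'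
    (measurable_gaussianPDF μ v) (ae_of_all _ fun _ => gaussianPDF_lt_top)]
  simp only [toReal_gaussianPDF, smul_eq_mul]

theorem integral_indicator_one_gaussianReal {v : ℝ≥0} (hv : v ≠ 0) (μ : ℝ) {s : Set ℝ}
    (hs : MeasurableSet s) :
    ∫ x, s.indicator (1 : ℝ → ℝ) x ∂(gaussianReal μ v) = ∫ x in s, gaussianPDFReal μ v x := by
  rw [integral_indicator hs, setIntegral_gaussianReal hv μ hs]
  simp

theorem integrable_sub_mul_sub_gaussianReal {μ : ℝ} {v : ℝ≥0} (a b : ℝ) :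
    Integrable (fun y => (y - a) * (y - b)) (gaussianReal μ v) := by
  have h : ∀ c : ℝ, MemLp (fun y : ℝ => y - c) 2 (gaussianReal μ v) := fun c =>
    (memLp_id_gaussianReal 2).sub (memLp_const c)
  exact (h a).integrable_mul (h b)

/-! ### Gaussian tails, Stein's identity and the scalar risk -/

/-- The probability that a Gaussian variable is at least `t` in absolute value. -/
noncomputable def gaussianTail (μ : ℝ) (v : ℝ≥0) (t : ℝ) : ℝ :=
  1 - ∫ y in (-t)..t, gaussianPDFReal μ v y

theorem gaussianTail_eq {v : ℝ≥0} (hv : v ≠ 0) (μ t : ℝ) :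
    gaussianTail μ v t =
      (∫ y in Set.Iic (-t), gaussianPDFReal μ v y) + ∫ y in Set.Ioi t, gaussianPDFReal μ v y := by
  have hi := integrable_gaussianPDFReal μ v
  have h1 := intervalIntegral.integral_Iic_add_Ioi (b := t) hi.integrableOn hi.integrableOn
  have h2 := intervalIntegral.integral_Iic_sub_Iic (a := -t) (b := t) hi.integrableOn
    hi.integrableOn
  rw [integral_gaussianPDFReal_eq_one μ hv] at h1
  rw [gaussianTail]
  linarith

theorem integrable_indicator_one {γ : Measure ℝ} [IsFiniteMeasure γ] {s : Set ℝ}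
    (hs : MeasurableSet s) : Integrable (fun x => s.indicator (1 : ℝ → ℝ) x) γ :=
  (integrable_const (1 : ℝ)).indicator hs

theorem integral_softSlope_sq {v : ℝ≥0} (hv : v ≠ 0) (μ : ℝ) {t : ℝ} (ht : 0 < t) :
    ∫ y, softSlope y t ^ 2 ∂(gaussianReal μ v) = gaussianTail μ v t := by
  simp_rw [softSlope_sq_eq_indicator ht]
  rw [integral_add (integrable_indicator_one measurableSet_Iic)
    (integrable_indicator_one measurableSet_Ici),
    integral_indicator_one_gaussianReal hv μ measurableSet_Iic,
    integral_indicator_one_gaussianReal hv μ measurableSet_Ici, gaussianTail_eq hv μ t,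
    integral_Ici_eq_integral_Ioi]

/-- Integration by parts packaged as one primitive: since p' = -(y - μ)p/v, the function -v(y - t)p
produces both sides of Stein's identity, and it vanishes at `y = t`. -/
theorem hasDerivAt_sub_mul_gaussianPDFReal {v : ℝ≥0} (hv : v ≠ 0) (μ t y : ℝ) :
    HasDerivAt (fun y => (y - t) * gaussianPDFReal μ v y * -v)
      (gaussianPDFReal μ v y * ((y - μ) * (y - t)) - v * gaussianPDFReal μ v y) y := by
  have hv0 : (v : ℝ) ≠ 0 := NNReal.coe_ne_zero.2 hv
  refine ((((hasDerivAt_id y).sub_const t).mul (hasDerivAt_gaussianPDFReal μ v y)).mul_const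
    (-(v : ℝ))).congr_deriv ?_
  simp only [id_eq]
  field_simp
  ring

theorem integrable_gaussianPDFReal_mul_sub_mul_sub {v : ℝ≥0} (hv : v ≠ 0) (μ t : ℝ) :
    Integrable (fun y => gaussianPDFReal μ v y * ((y - μ) * (y - t))) :=
  (integrable_gaussianReal_iff hv μ _).1 (integrable_sub_mul_sub_gaussianReal μ t)

theorem integrable_sub_mul_gaussianPDFReal {v : ℝ≥0} (hv : v ≠ 0) (μ t : ℝ) :
    Integrable (fun y => (y - t) * gaussianPDFReal μ v y * -v) := by
  have := (integrable_gaussianReal_iff hv μ (fun y => y - t)).1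
    (((memLp_id_gaussianReal 1).integrable le_rfl).sub (integrable_const t))
  simpa only [mul_comm] using this.mul_const (-(v : ℝ))

theorem setIntegral_Ioi_gaussian_stein {v : ℝ≥0} (hv : v ≠ 0) (μ t : ℝ) :
    ∫ y in Set.Ioi t, (y - μ) * (y - t) ∂(gaussianReal μ v) =
      v * ∫ y in Set.Ioi t, gaussianPDFReal μ v y := by
  have hd := hasDerivAt_sub_mul_gaussianPDFReal hv μ t
  have hi1 := integrable_gaussianPDFReal_mul_sub_mul_sub hv μ t
  have hi2 := (integrable_gaussianPDFReal μ v).const_mul (v : ℝ)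
  have hi3 := (hi1.sub hi2).integrableOn (s := Set.Ioi t)
  -- The primitive and its derivative are both integrable, so there is no boundary term at infinity.
  have h0 := tendsto_zero_of_hasDerivAt_of_integrableOn_Ioi (a := t) (fun y _ => hd y)
    hi3 (integrable_sub_mul_gaussianPDFReal hv μ t).integrableOn
  have h := integral_Ioi_of_hasDerivAt_of_tendsto' (a := t) (fun y _ => hd y) hi3 h0
  rw [integral_sub hi1.integrableOn hi2.integrableOn, integral_const_mul] at h
  rw [setIntegral_gaussianReal hv μ measurableSet_Ioi]
  linarith

theorem setIntegral_Iic_gaussian_stein {v : ℝ≥0} (hv : v ≠ 0) (μ t : ℝ) :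
    ∫ y in Set.Iic t, (y - μ) * (y - t) ∂(gaussianReal μ v) =
      v * ∫ y in Set.Iic t, gaussianPDFReal μ v y := by
  have hd := hasDerivAt_sub_mul_gaussianPDFReal hv μ t
  have hi1 := integrable_gaussianPDFReal_mul_sub_mul_sub hv μ t
  have hi2 := (integrable_gaussianPDFReal μ v).const_mul (v : ℝ)
  have hi3 := (hi1.sub hi2).integrableOn (s := Set.Iic t)
  have h0 := tendsto_zero_of_hasDerivAt_of_integrableOn_Iic (a := t) (fun y _ => hd y)
    hi3 (integrable_sub_mul_gaussianPDFReal hv μ t).integrableOn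
  have h := integral_Iic_of_hasDerivAt_of_tendsto' (a := t) (fun y _ => hd y) hi3 h0
  rw [integral_sub hi1.integrableOn hi2.integrableOn, integral_const_mul] at h
  rw [setIntegral_gaussianReal hv μ measurableSet_Iic]
  linarith

/-- Soft-thresholding is `y + t` on one half-line, `y - t` on the other and 0 between, so the
half-line identities at `-t` and `t` add up to the tail. -/
theorem integral_sub_mul_softScalar {v : ℝ≥0} (hv : v ≠ 0) (μ : ℝ) {t : ℝ} (ht : 0 < t) :
    ∫ y, (y - μ) * softScalar y t ∂(gaussianReal μ v) = v * gaussianTail μ v t := by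
  have h : ∀ y, (y - μ) * softScalar y t =
      (Set.Iic (-t)).indicator (fun y => (y - μ) * (y - -t)) y +
        (Set.Ioi t).indicator (fun y => (y - μ) * (y - t)) y := fun y => by
    simp only [softScalar, Set.indicator, Set.mem_Iic, Set.mem_Ioi]
    split_ifs <;> first | (exfalso; grind) | grind
  simp_rw [h]
  rw [integral_add ((integrable_sub_mul_sub_gaussianReal _ _).indicator measurableSet_Iic)
    ((integrable_sub_mul_sub_gaussianReal _ _).indicator measurableSet_Ioi),
    integral_indicator measurableSet_Iic, integral_indicator measurableSet_Ioi,
    setIntegral_Iic_gaussian_stein hv, setIntegral_Ioi_gaussian_stein hv, gaussianTail_eq hv μ t,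
    mul_add]

theorem memLp_softScalar {μ : ℝ} {v : ℝ≥0} {t : ℝ} (ht : 0 < t) :
    MemLp (fun y => softScalar y t) 2 (gaussianReal μ v) := by
  have h : MemLp (fun y => softScalar y t - y) 2 (gaussianReal μ v) :=
    MemLp.of_bound (by fun_prop) t (ae_of_all _ fun y => abs_softScalar_sub_le ht)
  have h' := h.add (memLp_id_gaussianReal 2)
  exact h'.ae_eq (ae_of_all _ fun y => sub_add_cancel _ _)

theorem integral_softScalar_sub_sq {v : ℝ≥0} (hv : v ≠ 0) (μ : ℝ) {t : ℝ} (ht : 0 < t) :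
    ∫ y, (softScalar y t - y) ^ 2 ∂(gaussianReal μ v) =
      t ^ 2 * gaussianTail μ v t + ∫ y in (-t)..t, gaussianPDFReal μ v y * y ^ 2 := by
  simp_rw [softScalar_sub_sq_eq ht]
  have h1 : Integrable (fun y => softSlope y t ^ 2) (gaussianReal μ v) :=
    Integrable.of_bound (by fun_prop) 1 (ae_of_all _ fun y => by
      simpa using softSlope_sq_le_one y t)
  have h2 : Integrable (fun y : ℝ => y ^ 2) (gaussianReal μ v) :=
    (memLp_id_gaussianReal 2).integrable_sq
  rw [integral_add (h1.const_mul _) (h2.indicator measurableSet_Ioo), integral_const_mul,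
    integral_softSlope_sq hv μ ht, integral_indicator measurableSet_Ioo,
    setIntegral_gaussianReal hv μ measurableSet_Ioo,
    intervalIntegral.integral_of_le (by linarith), integral_Ioc_eq_integral_Ioo]

/-- Expanding around `y` instead of `μ` isolates a cross term handled by Stein's identity. The last
integral does not depend on `t`, so it need not be evaluated. -/
theorem integral_softScalar_sub_mean_sq {v : ℝ≥0} (hv : v ≠ 0) (μ : ℝ) {t : ℝ} (ht : 0 < t) :
    ∫ y, (softScalar y t - μ) ^ 2 ∂(gaussianReal μ v) =
      t ^ 2 * gaussianTail μ v t + (∫ y in (-t)..t, gaussianPDFReal μ v y * y ^ 2) +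
        2 * v * gaussianTail μ v t + ∫ y, (μ ^ 2 - y ^ 2) ∂(gaussianReal μ v) := by
  have hid : MemLp (fun y : ℝ => y) 2 (gaussianReal μ v) := memLp_id_gaussianReal 2
  have h1 : Integrable (fun y => (softScalar y t - y) ^ 2) (gaussianReal μ v) :=
    ((memLp_softScalar ht).sub hid).integrable_sq
  have h2 : Integrable (fun y => 2 * ((y - μ) * softScalar y t)) (gaussianReal μ v) :=
    ((hid.sub (memLp_const μ)).integrable_mul (memLp_softScalar ht)).const_mul 2
  have h3 : Integrable (fun y : ℝ => μ ^ 2 - y ^ 2) (gaussianReal μ v) :=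
    (integrable_const _).sub hid.integrable_sq
  have h : ∀ y, (softScalar y t - μ) ^ 2 =
      (softScalar y t - y) ^ 2 + 2 * ((y - μ) * softScalar y t) + (μ ^ 2 - y ^ 2) := fun y => by
    ring
  simp_rw [h]
  rw [integral_add (f := fun y => (softScalar y t - y) ^ 2 + 2 * ((y - μ) * softScalar y t))
    (h1.add h2) h3, integral_add h1 h2, integral_const_mul,
    integral_sub_mul_softScalar hv μ ht, integral_softScalar_sub_sq hv μ ht]
  ring

theorem hasDerivAt_integral_neg_self {h : ℝ → ℝ} (hh : Continuous h) (t : ℝ) :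
    HasDerivAt (fun t => ∫ y in (-t)..t, h y) (h t + h (-t)) t := by
  have e : (fun t => ∫ y in (-t)..t, h y) =
      fun t => (∫ y in (0 : ℝ)..t, h y) - ∫ y in (0 : ℝ)..(-t), h y := by
    ext t
    rw [intervalIntegral.integral_interval_sub_left (hh.intervalIntegrable _ _)
      (hh.intervalIntegrable _ _)]
  rw [e]
  have h1 := intervalIntegral.integral_hasDerivAt_right (hh.intervalIntegrable 0 t)
    (hh.stronglyMeasurableAtFilter _ _) hh.continuousAt
  have h2 := intervalIntegral.integral_hasDerivAt_right (hh.intervalIntegrable 0 (-t))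
    (hh.stronglyMeasurableAtFilter _ _) hh.continuousAt
  refine (h1.sub (h2.comp t (hasDerivAt_neg t))).congr_deriv ?_
  ring

/-- The derivative of `gaussianTail`. -/
noncomputable def gaussianTailDeriv (μ : ℝ) (v : ℝ≥0) (t : ℝ) : ℝ :=
  -(gaussianPDFReal μ v t + gaussianPDFReal μ v (-t))

@[fun_prop]
theorem continuous_gaussianTailDeriv (μ : ℝ) (v : ℝ≥0) : Continuous (gaussianTailDeriv μ v) := by
  unfold gaussianTailDeriv
  fun_prop

theorem hasDerivAt_gaussianTail (μ : ℝ) (v : ℝ≥0) (t : ℝ) :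
    HasDerivAt (gaussianTail μ v) (gaussianTailDeriv μ v t) t :=
  (hasDerivAt_integral_neg_self (continuous_gaussianPDFReal μ v) t).const_sub 1

@[fun_prop]
theorem continuous_gaussianTail (μ : ℝ) (v : ℝ≥0) : Continuous (gaussianTail μ v) :=
  continuous_iff_continuousAt.2 fun t => (hasDerivAt_gaussianTail μ v t).continuousAt

theorem hasDerivAt_integral_softScalar_sub_mean_sq {v : ℝ≥0} (hv : v ≠ 0) (μ : ℝ) {t : ℝ}
    (ht : 0 < t) :
    HasDerivAt (fun t => ∫ y, (softScalar y t - μ) ^ 2 ∂(gaussianReal μ v))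
      (2 * t * gaussianTail μ v t + 2 * v * gaussianTailDeriv μ v t) t := by
  have hD := hasDerivAt_gaussianTail μ v t
  have hI := hasDerivAt_integral_neg_self (h := fun y => gaussianPDFReal μ v y * y ^ 2)
    (by fun_prop) t
  have h := (((((hasDerivAt_id t).fun_pow 2).mul hD).add hI).add
    (hD.const_mul (2 * (v : ℝ)))).add_const (∫ y, (μ ^ 2 - y ^ 2) ∂(gaussianReal μ v))
  refine (h.congr_of_eventuallyEq ?_).congr_deriv ?_
  · filter_upwards [Ioi_mem_nhds ht] with s hs
    exact integral_softScalar_sub_mean_sq hv μ hs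
  -- The boundary terms t²(p(t) + p(-t)) from the tail and from the truncated second moment cancel.
  · simp only [gaussianTailDeriv, id_eq]
    push_cast
    ring

/-! ### Bias and second moment of the finite-difference slope -/

theorem integrable_softSlopeFD {μ : ℝ} {v : ℝ≥0} {ε : ℝ} (hε : 0 < ε) (t : ℝ) :
    Integrable (softSlopeFD ε t) (gaussianReal μ v) :=
  Integrable.of_bound (by fun_prop) (2 / ε) (ae_of_all _ fun y => abs_softSlopeFD_le hε t y)

theorem integral_softSlopeFD {v : ℝ≥0} (hv : v ≠ 0) (μ : ℝ) {t ε : ℝ} (ht : 0 < t) (hε : 0 < ε) :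
    ∫ y, softSlopeFD ε t y ∂(gaussianReal μ v) =
      -((∫ y in (-t - ε)..(-t), gaussianPDFReal μ v y) +
        ∫ y in (t - ε)..t, gaussianPDFReal μ v y) / ε := by
  simp_rw [softSlopeFD_eq ht hε]
  rw [integral_div, integral_neg, integral_add (integrable_indicator_one measurableSet_Ioc)
    (integrable_indicator_one measurableSet_Ico),
    integral_indicator_one_gaussianReal hv μ measurableSet_Ioc,
    integral_indicator_one_gaussianReal hv μ measurableSet_Ico,
    intervalIntegral.integral_of_le (by linarith), intervalIntegral.integral_of_le (by linarith),
    integral_Ico_eq_integral_Ioo, integral_Ioc_eq_integral_Ioo, integral_Ioc_eq_integral_Ioo]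

/-- Replacing the density on a window by its value at the right endpoint costs at most L ε per unit
length. Two windows of length `ε`, divided by `ε`, give the constant 2L. -/
theorem exists_abs_integral_softSlopeFD_sub_le {v : ℝ≥0} (hv : v ≠ 0) {t : ℝ} (ht : 0 < t) :
    ∃ L : ℝ, 0 ≤ L ∧ ∀ μ ε : ℝ, 0 < ε →
      |∫ y, softSlopeFD ε t y ∂(gaussianReal μ v) - gaussianTailDeriv μ v t| ≤ L * ε := by
  obtain ⟨L, hL, h⟩ := exists_abs_gaussianPDFReal_sub_le hv
  refine ⟨2 * L, by positivity, fun μ ε hε => ?_⟩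
  have key : ∀ x, |(∫ y in (x - ε)..x, gaussianPDFReal μ v y) - ε * gaussianPDFReal μ v x| ≤
      L * ε * ε := fun x => by
    have hc : ε * gaussianPDFReal μ v x = ∫ _ in (x - ε)..x, gaussianPDFReal μ v x := by
      simp
    rw [hc, ← intervalIntegral.integral_sub
      ((continuous_gaussianPDFReal μ v).intervalIntegrable _ _) (by simp)]
    have hb : ∀ y ∈ Set.uIoc (x - ε) x, ‖gaussianPDFReal μ v y - gaussianPDFReal μ v x‖ ≤ L * ε := by
      intro y hy
      rw [Set.uIoc_of_le (by linarith)] at hy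
      refine (h μ x y).trans ?_
      gcongr
      rw [abs_le]
      constructor <;> linarith [hy.1, hy.2]
    refine (intervalIntegral.norm_integral_le_of_norm_le_const hb).trans_eq ?_
    rw [sub_sub_cancel, abs_of_pos hε]
  have e : ∫ y, softSlopeFD ε t y ∂(gaussianReal μ v) - gaussianTailDeriv μ v t =
      -(((∫ y in (-t - ε)..(-t), gaussianPDFReal μ v y) - ε * gaussianPDFReal μ v (-t)) +
        ((∫ y in (t - ε)..t, gaussianPDFReal μ v y) - ε * gaussianPDFReal μ v t)) / ε := by
    rw [integral_softSlopeFD hv μ ht hε, gaussianTailDeriv]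
    field_simp
    ring
  rw [e, abs_div, abs_neg, abs_of_pos hε, div_le_iff₀ hε]
  refine (abs_add_le _ _).trans ((add_le_add (key _) (key _)).trans_eq ?_)
  ring

/-- With K the peak of the density, the two windows have total mass at most 2Kε; hence the mean
absolute value is at most 2K, and the factor 2/ε gives 4K/ε. -/
theorem exists_integral_softSlopeFD_sq_le {v : ℝ≥0} (hv : v ≠ 0) {t : ℝ} (ht : 0 < t) :
    ∃ C : ℝ, 0 ≤ C ∧ ∀ μ ε : ℝ, 0 < ε →
      ∫ y, softSlopeFD ε t y ^ 2 ∂(gaussianReal μ v) ≤ C / ε := by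
  set K := (√(2 * Real.pi * v))⁻¹ with hK
  refine ⟨4 * K, by positivity, fun μ ε hε => ?_⟩
  have key : ∀ x, (∫ y in (x - ε)..x, gaussianPDFReal μ v y) ≤ ε * K := fun x => by
    have hc : ε * K = ∫ _ in (x - ε)..x, K := by simp
    rw [hc]
    exact intervalIntegral.integral_mono_on (by linarith)
      ((continuous_gaussianPDFReal μ v).intervalIntegrable _ _) (by simp)
      fun y _ => gaussianPDFReal_le μ v y
  calc ∫ y, softSlopeFD ε t y ^ 2 ∂(gaussianReal μ v)
      ≤ ∫ y, 2 / ε * -softSlopeFD ε t y ∂(gaussianReal μ v) :=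
        integral_mono_of_nonneg (ae_of_all _ fun y => sq_nonneg _)
          ((integrable_softSlopeFD hε t).neg.const_mul _)
          (ae_of_all _ fun y => softSlopeFD_sq_le ht hε y)
    _ = 2 / ε * (((∫ y in (-t - ε)..(-t), gaussianPDFReal μ v y) +
        ∫ y in (t - ε)..t, gaussianPDFReal μ v y) / ε) := by
        rw [integral_const_mul, integral_neg, integral_softSlopeFD hv μ ht hε]
        ring
    _ ≤ 2 / ε * ((ε * K + ε * K) / ε) := by
        gcongr
        · exact key _
        · exact key _
    _ = 4 * K / ε := by
        field_simp
        ring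

/-! ### The noise vector: independence and concentration -/

instance isGaussian_noiseLaw (P : ℕ) (σ : ℝ) : IsGaussian (noiseLaw P σ) :=
  isGaussian_multivariateGaussian

theorem posSemidef_sq_smul_one (P : ℕ) (σ : ℝ) :
    (σ ^ 2 • (1 : Matrix (Fin P) (Fin P) ℝ)).PosSemidef :=
  Matrix.PosSemidef.one.smul (sq_nonneg σ)

theorem hasLaw_add_noise {P : ℕ} (σ : ℝ) (μ₀ : EuclideanSpace ℝ (Fin P)) (i : Fin P) :
    HasLaw (fun w => (μ₀ + w) i) (gaussianReal (μ₀ i) (σ ^ 2).toNNReal) (noiseLaw P σ) := by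
  have h := (measurePreserving_eval_multivariateGaussian (μ := (0 : EuclideanSpace ℝ (Fin P)))
    (posSemidef_sq_smul_one P σ) (i := i)).hasLaw
  have h' := gaussianReal_const_add h (μ₀ i)
  simpa [noiseLaw] using h'

theorem iIndepFun_noiseLaw (P : ℕ) (σ : ℝ) :
    iIndepFun (fun (i : Fin P) (w : EuclideanSpace ℝ (Fin P)) => w i) (noiseLaw P σ) := by
  have h : HasGaussianLaw (fun (w : EuclideanSpace ℝ (Fin P)) i => w i) (noiseLaw P σ) :=
    (IsGaussian.hasGaussianLaw_id (μ := noiseLaw P σ)).map_fun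
      (EuclideanSpace.equiv (Fin P) ℝ).toContinuousLinearMap
  refine h.iIndepFun_of_covariance_eq_zero fun i j hij => ?_
  rw [noiseLaw, covariance_eval_multivariateGaussian (posSemidef_sq_smul_one P σ)]
  simp [hij]

/-- Chebyshev's inequality for a sum of independent terms, each variance being bounded by a second
moment. The bound `V` is uniform in the mean because the coordinates are not identically
distributed. -/
theorem noiseLaw_abs_sum_sub_ge_le {P : ℕ} (σ : ℝ) (μ₀ : EuclideanSpace ℝ (Fin P)) {f : ℝ → ℝ}
    (hf : Measurable f) {C : ℝ} (hC : ∀ y, |f y| ≤ C) {V : ℝ}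
    (hV : ∀ μ, ∫ y, f y ^ 2 ∂(gaussianReal μ (σ ^ 2).toNNReal) ≤ V) {c : ℝ} (hc : 0 < c) :
    noiseLaw P σ {w | c ≤ |∑ i, f ((μ₀ + w) i) -
      ∑ i, ∫ y, f y ∂(gaussianReal (μ₀ i) (σ ^ 2).toNNReal)|} ≤ ENNReal.ofReal (P * V / c ^ 2) := by
  set X : Fin P → EuclideanSpace ℝ (Fin P) → ℝ := fun i w => f ((μ₀ + w) i) with hX
  have hm : ∀ i, Measurable (X i) := fun i => hf.comp (by fun_prop)
  have hLp : ∀ i, MemLp (X i) 2 (noiseLaw P σ) := fun i =>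
    MemLp.of_bound (hm i).aestronglyMeasurable C (ae_of_all _ fun w => hC _)
  have hE : ∀ i, ∫ w, X i w ∂(noiseLaw P σ) =
      ∫ y, f y ∂(gaussianReal (μ₀ i) (σ ^ 2).toNNReal) := fun i =>
    (hasLaw_add_noise σ μ₀ i).integral_comp hf.aestronglyMeasurable
  have hVar : ∀ i, Var[X i; noiseLaw P σ] ≤ V := fun i => by
    refine (variance_le_expectation_sq (hm i).aestronglyMeasurable).trans ?_
    refine le_trans (le_of_eq ?_) (hV (μ₀ i))
    exact (hasLaw_add_noise σ μ₀ i).integral_comp (f := fun y => f y ^ 2)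
      (hf.pow_const 2).aestronglyMeasurable
  have hind : iIndepFun X (noiseLaw P σ) :=
    (iIndepFun_noiseLaw P σ).comp (fun i x => f (μ₀ i + x))
      fun i => hf.comp (measurable_const_add _)
  have hVarS : Var[∑ i, X i; noiseLaw P σ] ≤ P * V := by
    rw [IndepFun.variance_sum (fun i _ => hLp i) fun i _ j _ hij => hind.indepFun hij]
    refine (Finset.sum_le_sum fun i _ => hVar i).trans_eq ?_
    simp
  have hES : ∫ w, (∑ i, X i) w ∂(noiseLaw P σ) =
      ∑ i, ∫ y, f y ∂(gaussianReal (μ₀ i) (σ ^ 2).toNNReal) := by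
    simp_rw [Finset.sum_apply]
    rw [integral_finsetSum _ fun i _ => (hLp i).integrable one_le_two]
    exact Finset.sum_congr rfl fun i _ => hE i
  have h := meas_ge_le_variance_div_sq (memLp_finsetSum' Finset.univ fun i _ => hLp i) hc
  rw [hES] at h
  simp only [Finset.sum_apply] at h
  refine h.trans (ENNReal.ofReal_le_ofReal ?_)
  gcongr

/-- A deviation of size δ splits into bias and fluctuation. Once the bias is below δ/2, the centred
sum must exceed Pδ/2, and Chebyshev bounds this by PV/(Pδ/2)² = (4/δ²)(V/P). -/
theorem tendstoInMeasure_average_sub {Ω : Type*} [MeasurableSpace Ω] {Pr : Measure Ω} {σ : ℝ}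
    {W : (P : ℕ) → Ω → EuclideanSpace ℝ (Fin P)}
    (hW : ∀ P : ℕ, 1 ≤ P → HasLaw (W P) (noiseLaw P σ) Pr)
    (μ₀ : (P : ℕ) → EuclideanSpace ℝ (Fin P)) {f m : ℕ → ℝ → ℝ} {V b C : ℕ → ℝ}
    (hf : ∀ P, Measurable (f P)) (hC : ∀ P, 1 ≤ P → ∀ y, |f P y| ≤ C P)
    (hV : ∀ P, 1 ≤ P → ∀ μ, ∫ y, f P y ^ 2 ∂(gaussianReal μ (σ ^ 2).toNNReal) ≤ V P)
    (hb : ∀ P, 1 ≤ P → ∀ μ, |∫ y, f P y ∂(gaussianReal μ (σ ^ 2).toNNReal) - m P μ| ≤ b P)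
    (hVlim : Tendsto (fun P : ℕ => V P / P) atTop (𝓝 0)) (hblim : Tendsto b atTop (𝓝 0)) :
    TendstoInMeasure Pr
      (fun (P : ℕ) ω => 1 / (P : ℝ) * (∑ i, f P ((μ₀ P + W P ω) i) - ∑ i, m P (μ₀ P i)))
      atTop (fun _ => 0) := by
  rw [tendstoInMeasure_iff_norm]
  intro δ hδ
  have hlim : Tendsto (fun P : ℕ => ENNReal.ofReal (4 / δ ^ 2 * (V P / P))) atTop (𝓝 0) := by
    have := ENNReal.tendsto_ofReal (hVlim.const_mul (4 / δ ^ 2))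
    rwa [mul_zero, ENNReal.ofReal_zero] at this
  refine tendsto_of_tendsto_of_tendsto_of_le_of_le' tendsto_const_nhds hlim
    (Eventually.of_forall fun _ => zero_le) ?_
  filter_upwards [eventually_ge_atTop 1, hblim.eventually_lt_const (half_pos hδ)] with P hP hbP
  have hP0 : (0 : ℝ) < P := by exact_mod_cast hP
  set E := ∑ i, ∫ y, f P y ∂(gaussianReal (μ₀ P i) (σ ^ 2).toNNReal) with hE
  have hEm : |E - ∑ i, m P (μ₀ P i)| ≤ P * (δ / 2) := by
    rw [hE, ← Finset.sum_sub_distrib]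
    refine (Finset.abs_sum_le_sum_abs _ _).trans
      ((Finset.sum_le_sum fun i _ => (hb P hP _).trans hbP.le).trans_eq ?_)
    simp
  have hmeas : MeasurableSet {w : EuclideanSpace ℝ (Fin P) |
      P * (δ / 2) ≤ |∑ i, f P ((μ₀ P + w) i) - E|} := by
    refine measurableSet_le measurable_const ?_
    have : ∀ i, Measurable fun w : EuclideanSpace ℝ (Fin P) => f P ((μ₀ P + w) i) := fun i =>
      (hf P).comp (by fun_prop)
    fun_prop
  calc Pr {ω | δ ≤ ‖1 / (P : ℝ) * (∑ i, f P ((μ₀ P + W P ω) i) - ∑ i, m P (μ₀ P i)) - 0‖}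
      ≤ Pr {ω | P * (δ / 2) ≤ |∑ i, f P ((μ₀ P + W P ω) i) - E|} := by
        refine measure_mono fun ω hω => ?_
        simp only [Set.mem_ofPred_eq, sub_zero, norm_mul, norm_div, norm_one, Nat.abs_cast,
          Real.norm_eq_abs] at hω ⊢
        rw [one_div, ← div_eq_inv_mul, le_div_iff₀ hP0] at hω
        have := abs_sub_le (∑ i, f P ((μ₀ P + W P ω) i)) E (∑ i, m P (μ₀ P i))
        linarith
    _ = noiseLaw P σ {w | P * (δ / 2) ≤ |∑ i, f P ((μ₀ P + w) i) - E|} :=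
        (hW P hP).measure_eq hmeas
    _ ≤ ENNReal.ofReal (P * V P / (P * (δ / 2)) ^ 2) :=
        noiseLaw_abs_sum_sub_ge_le σ (μ₀ P) (hf P) (hC P hP) (hV P hP) (by positivity)
    _ = ENNReal.ofReal (4 / δ ^ 2 * (V P / P)) := by
        congr 1
        field_simp
        ring

theorem ae_ne_abs_gaussianReal {v : ℝ≥0} (hv : v ≠ 0) (μ lam ε : ℝ) :
    ∀ᵐ y ∂(gaussianReal μ v), lam ≠ |y| ∧ lam ≠ |y + ε| := by
  have := nullSingletonClass_gaussianReal (μ := μ) hv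
  -- These are the solutions of |y| = lam or |y + ε| = lam; a nondegenerate Gaussian does not charge
  -- them.
  have hfin : ({lam, -lam, lam - ε, -lam - ε} : Set ℝ).Countable := (Set.toFinite _).countable
  filter_upwards [hfin.ae_notMem (gaussianReal μ v)] with y hy
  simp only [Set.mem_insert_iff, Set.mem_singleton_iff, not_or] at hy
  obtain ⟨h1, h2, h3, h4⟩ := hy
  constructor <;> rintro rfl
  · rcases abs_choice y with h | h <;> rw [h] at h1 h2
    · exact h1 rfl
    · exact h2 (neg_neg y).symm
  · rcases abs_choice (y + ε) with h | h <;> rw [h] at h3 h4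
    · exact h3 (by ring)
    · exact h4 (by ring)

/-! ### Reduction of the vector quantities to coordinates -/

theorem softThreshold_norm_sub_sq {P : ℕ} (y x : EuclideanSpace ℝ (Fin P)) (t : ℝ) :
    ‖softThreshold y t - x‖ ^ 2 = ∑ i, (softScalar (y i) t - x i) ^ 2 := by
  rw [EuclideanSpace.real_norm_sq_eq]
  rfl

theorem dofFD_softThreshold {P : ℕ} (y : EuclideanSpace ℝ (Fin P)) (t ε : ℝ) :
    dofFD softThreshold y t ε = ∑ i, (softScalar (y i + ε) t - softScalar (y i) t) / ε := by
  rw [dofFD, Finset.mul_sum]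
  refine Finset.sum_congr rfl fun i _ => ?_
  rw [PiLp.sub_apply, softThreshold_apply, softThreshold_apply]
  simp [div_eq_inv_mul]

theorem risk_softThreshold {P : ℕ} (σ : ℝ) (μ₀ : EuclideanSpace ℝ (Fin P)) {t : ℝ} (ht : 0 < t) :
    risk softThreshold σ μ₀ t =
      ∑ i, ∫ y, (softScalar y t - μ₀ i) ^ 2 ∂(gaussianReal (μ₀ i) (σ ^ 2).toNNReal) := by
  simp_rw [risk, softThreshold_norm_sub_sq]
  have hint : ∀ i, Integrable (fun y => (softScalar y t - μ₀ i) ^ 2)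
      (gaussianReal (μ₀ i) (σ ^ 2).toNNReal) := fun i =>
    ((memLp_softScalar ht).sub (memLp_const (μ₀ i))).integrable_sq
  rw [integral_finsetSum]
  · exact Finset.sum_congr rfl fun i _ =>
      (hasLaw_add_noise σ μ₀ i).integral_comp (hint i).aestronglyMeasurable
  · intro i _
    have hl := hasLaw_add_noise σ μ₀ i
    have := hint i
    rw [← hl.map_eq] at this
    exact this.comp_aemeasurable hl.aemeasurable

theorem dof_softThreshold {P : ℕ} {σ : ℝ} (hσ : 0 < σ) (μ₀ : EuclideanSpace ℝ (Fin P)) {t : ℝ}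
    (ht : 0 < t) :
    dof softThreshold σ μ₀ t = ∑ i, gaussianTail (μ₀ i) (σ ^ 2).toNNReal t := by
  have hv : (σ ^ 2).toNNReal ≠ 0 := (Real.toNNReal_pos.2 (by positivity)).ne'
  refine Finset.sum_congr rfl fun i _ => ?_
  set γ := gaussianReal (μ₀ i) (σ ^ 2).toNNReal with hγ
  have hid : MemLp (fun y : ℝ => y) 2 γ := memLp_id_gaussianReal 2
  have hs : MemLp (fun y => softScalar y t) 2 γ := memLp_softScalar ht
  have h1 : cov[fun w => (μ₀ + w) i, fun w => softThreshold (μ₀ + w) t i; noiseLaw P σ] =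
      cov[fun y => y, fun y => softScalar y t; γ] :=
    (hasLaw_add_noise σ μ₀ i).covariance_fun_comp (f := fun y => y)
      (g := fun y => softScalar y t) (by fun_prop) (by fun_prop)
  have h2 := integral_sub_mul_softScalar hv (μ₀ i) ht
  simp_rw [sub_mul] at h2
  rw [integral_sub (f := fun y => y * softScalar y t) (hid.integrable_mul hs)
    ((hs.integrable one_le_two).const_mul _),
    integral_const_mul] at h2
  rw [h1, covariance_eq_sub hid hs, div_eq_iff (by positivity)]
  rw [Real.coe_toNNReal _ (sq_nonneg σ)] at h2
  simp only [Pi.mul_apply]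
  rw [hγ, integral_id_gaussianReal, h2, mul_comm]

/-! ### Weak gradients of the risk, the degrees of freedom and the estimators -/

theorem hasWeakGradAt_risk_softThreshold {P : ℕ} {σ : ℝ} (hσ : 0 < σ)
    (μ₀ : EuclideanSpace ℝ (Fin P)) (lam : ℝ) :
    HasWeakGradAt (risk softThreshold σ μ₀) lam
      (∑ i, (2 * lam * gaussianTail (μ₀ i) (σ ^ 2).toNNReal lam +
        2 * σ ^ 2 * gaussianTailDeriv (μ₀ i) (σ ^ 2).toNNReal lam)) := by
  have hv : (σ ^ 2).toNNReal ≠ 0 := (Real.toNNReal_pos.2 (by positivity)).ne'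
  have hd : ∀ t ∈ Set.Ioi (0 : ℝ), HasDerivAt (risk softThreshold σ μ₀)
      (∑ i, (2 * t * gaussianTail (μ₀ i) (σ ^ 2).toNNReal t +
        2 * σ ^ 2 * gaussianTailDeriv (μ₀ i) (σ ^ 2).toNNReal t)) t := fun t ht => by
    have h := HasDerivAt.fun_sum (u := Finset.univ) fun i _ =>
      hasDerivAt_integral_softScalar_sub_mean_sq hv (μ₀ i) ht
    rw [Real.coe_toNNReal _ (sq_nonneg σ)] at h
    refine h.congr_of_eventuallyEq ?_
    filter_upwards [Ioi_mem_nhds ht] with s hs using risk_softThreshold σ μ₀ hs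
  have hc : Continuous fun t => ∑ i, (2 * t * gaussianTail (μ₀ i) (σ ^ 2).toNNReal t +
      2 * σ ^ 2 * gaussianTailDeriv (μ₀ i) (σ ^ 2).toNNReal t) := by fun_prop
  exact hasWeakGradAt_of_hasDerivAt_off_countable
    (g := fun t => ∑ i, (2 * t * gaussianTail (μ₀ i) (σ ^ 2).toNNReal t +
      2 * σ ^ 2 * gaussianTailDeriv (μ₀ i) (σ ^ 2).toNNReal t)) Set.countable_empty
    (fun t ht => (hd t ht).continuousAt.continuousWithinAt) (fun t ht => hd t ht.1)
    (hc.locallyIntegrable.locallyIntegrableOn _) hc.continuousAt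

theorem hasWeakGradAt_dof_softThreshold {P : ℕ} {σ : ℝ} (hσ : 0 < σ)
    (μ₀ : EuclideanSpace ℝ (Fin P)) (lam : ℝ) :
    HasWeakGradAt (dof softThreshold σ μ₀) lam
      (∑ i, gaussianTailDeriv (μ₀ i) (σ ^ 2).toNNReal lam) := by
  have hd : ∀ t ∈ Set.Ioi (0 : ℝ), HasDerivAt (dof softThreshold σ μ₀)
      (∑ i, gaussianTailDeriv (μ₀ i) (σ ^ 2).toNNReal t) t := fun t ht => by
    refine (HasDerivAt.fun_sum (u := Finset.univ) fun i _ =>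
      hasDerivAt_gaussianTail (μ₀ i) (σ ^ 2).toNNReal t).congr_of_eventuallyEq ?_
    filter_upwards [Ioi_mem_nhds ht] with s hs using dof_softThreshold hσ μ₀ hs
  have hc : Continuous fun t => ∑ i, gaussianTailDeriv (μ₀ i) (σ ^ 2).toNNReal t := by fun_prop
  exact hasWeakGradAt_of_hasDerivAt_off_countable
    (g := fun t => ∑ i, gaussianTailDeriv (μ₀ i) (σ ^ 2).toNNReal t) Set.countable_empty
    (fun t ht => (hd t ht).continuousAt.continuousWithinAt) (fun t ht => hd t ht.1)
    (hc.locallyIntegrable.locallyIntegrableOn _) hc.continuousAt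

/-- The thresholds at which the finite-difference estimators need not be differentiable. -/
def exceptionalThresholds {P : ℕ} (y : EuclideanSpace ℝ (Fin P)) (ε : ℝ) : Set ℝ :=
  ⋃ i, {|y i|, |y i + ε|}

theorem countable_exceptionalThresholds {P : ℕ} (y : EuclideanSpace ℝ (Fin P)) (ε : ℝ) :
    (exceptionalThresholds y ε).Countable :=
  Set.countable_iUnion fun _ => (Set.toFinite _).countable

theorem ne_of_notMem_exceptionalThresholds {P : ℕ} {y : EuclideanSpace ℝ (Fin P)} {ε t : ℝ}
    (ht : t ∉ exceptionalThresholds y ε) (i : Fin P) : t ≠ |y i| ∧ t ≠ |y i + ε| := by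
  simp only [exceptionalThresholds, Set.mem_iUnion, not_exists, Set.mem_insert_iff,
    Set.mem_singleton_iff, not_or] at ht
  exact ht i

theorem hasDerivAt_dofFD_softThreshold {P : ℕ} {y : EuclideanSpace ℝ (Fin P)} {ε t : ℝ}
    (ht : 0 < t) (hy : ∀ i, t ≠ |y i| ∧ t ≠ |y i + ε|) :
    HasDerivAt (fun t => dofFD softThreshold y t ε) (∑ i, softSlopeFD ε t (y i)) t := by
  simp_rw [dofFD_softThreshold]
  exact HasDerivAt.fun_sum fun i _ =>
    ((hasDerivAt_softScalar ht (hy i).2).sub (hasDerivAt_softScalar ht (hy i).1)).div_const ε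

theorem continuousOn_dofFD_softThreshold {P : ℕ} (y : EuclideanSpace ℝ (Fin P)) (ε : ℝ) :
    ContinuousOn (fun t => dofFD softThreshold y t ε) (Set.Ioi 0) := by
  simp_rw [dofFD_softThreshold]
  exact continuousOn_finsetSum _ fun i _ =>
    ((continuousOn_softScalar _).sub (continuousOn_softScalar _)).div_const ε

theorem locallyIntegrable_sum_softSlopeFD {P : ℕ} (y : EuclideanSpace ℝ (Fin P)) (ε : ℝ) :
    LocallyIntegrable (fun t => ∑ i, softSlopeFD ε t (y i)) volume := by
  refine locallyIntegrable_finsetSum _ fun i _ => ?_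
  simp only [softSlopeFD, div_eq_inv_mul]
  exact ((locallyIntegrable_softSlope (y i + ε)).sub (locallyIntegrable_softSlope (y i))).smul ε⁻¹

theorem continuousAt_sum_softSlopeFD {P : ℕ} {y : EuclideanSpace ℝ (Fin P)} {ε t : ℝ}
    (ht : 0 < t) (hy : ∀ i, t ≠ |y i| ∧ t ≠ |y i + ε|) :
    ContinuousAt (fun t => ∑ i, softSlopeFD ε t (y i)) t :=
  tendsto_finsetSum _ fun i _ => ((continuousAt_softSlope ht (hy i).2).sub
    (continuousAt_softSlope ht (hy i).1)).div_const ε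

theorem hasWeakGradAt_dofFD_softThreshold {P : ℕ} {y : EuclideanSpace ℝ (Fin P)} {ε lam : ℝ}
    (hlam : 0 < lam) (hy : ∀ i, lam ≠ |y i| ∧ lam ≠ |y i + ε|) :
    HasWeakGradAt (fun t => dofFD softThreshold y t ε) lam (∑ i, softSlopeFD ε lam (y i)) :=
  hasWeakGradAt_of_hasDerivAt_off_countable (g := fun t => ∑ i, softSlopeFD ε t (y i))
    (countable_exceptionalThresholds y ε) (continuousOn_dofFD_softThreshold y ε)
    (fun _ ht => hasDerivAt_dofFD_softThreshold ht.1 (ne_of_notMem_exceptionalThresholds ht.2))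
    ((locallyIntegrable_sum_softSlopeFD y ε).locallyIntegrableOn _)
    (continuousAt_sum_softSlopeFD hlam hy)

/-- The weak gradient in the threshold of the finite-difference SURE, per coordinate. -/
noncomputable def softSugar (σ ε t y : ℝ) : ℝ :=
  2 * t * softSlope y t ^ 2 + 2 * σ ^ 2 * softSlopeFD ε t y

theorem sum_softSugar {P : ℕ} (σ ε t : ℝ) (y : EuclideanSpace ℝ (Fin P)) :
    ∑ i, softSugar σ ε t (y i) =
      ∑ i, 2 * t * softSlope (y i) t ^ 2 + 2 * σ ^ 2 * ∑ i, softSlopeFD ε t (y i) := by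
  simp only [softSugar, Finset.sum_add_distrib, Finset.mul_sum]

theorem hasWeakGradAt_sureFD_softThreshold {P : ℕ} (σ : ℝ) {y : EuclideanSpace ℝ (Fin P)}
    {ε lam : ℝ} (hlam : 0 < lam) (hy : ∀ i, lam ≠ |y i| ∧ lam ≠ |y i + ε|) :
    HasWeakGradAt (fun t => sureFD softThreshold σ y t ε) lam (∑ i, softSugar σ ε lam (y i)) := by
  refine hasWeakGradAt_of_hasDerivAt_off_countable (g := fun t => ∑ i, softSugar σ ε t (y i))
    (countable_exceptionalThresholds y ε) ?_ (fun t ht => ?_) ?_ ?_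
  · simp_rw [sureFD, softThreshold_norm_sub_sq]
    refine ContinuousOn.add (ContinuousOn.sub (continuousOn_finsetSum _ fun i _ => ?_)
      continuousOn_const) (continuousOn_const.mul (continuousOn_dofFD_softThreshold y ε))
    exact ((continuousOn_softScalar _).sub continuousOn_const).pow 2
  · have hy' := ne_of_notMem_exceptionalThresholds ht.2
    simp_rw [sureFD, softThreshold_norm_sub_sq, sum_softSugar]
    exact ((HasDerivAt.fun_sum fun i _ => hasDerivAt_softScalar_sub_sq ht.1 (hy' i).1).sub_const
      _).add ((hasDerivAt_dofFD_softThreshold ht.1 hy').const_mul _)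
  · simp_rw [sum_softSugar]
    exact ((locallyIntegrable_finsetSum _ fun i _ =>
      locallyIntegrable_mul_softSlope_sq (y i)).add
        ((locallyIntegrable_sum_softSlopeFD y ε).smul (2 * σ ^ 2))).locallyIntegrableOn _
  · simp_rw [sum_softSugar]
    exact (tendsto_finsetSum _ fun i _ => continuousAt_mul_softSlope_sq hlam (hy i).1).add
      ((continuousAt_sum_softSlopeFD hlam hy).const_mul _)

@[fun_prop]
theorem measurable_softSugar (σ ε t : ℝ) : Measurable (softSugar σ ε t) := by
  unfold softSugar
  fun_prop

theorem abs_softSugar_le {σ ε t : ℝ} (hε : 0 < ε) (ht : 0 < t) (y : ℝ) :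
    |softSugar σ ε t y| ≤ 2 * t + 2 * σ ^ 2 * (2 / ε) := by
  refine (abs_add_le _ _).trans (add_le_add ?_ ?_)
  · rw [abs_of_nonneg (by positivity)]
    exact mul_le_of_le_one_right (by positivity) (softSlope_sq_le_one y t)
  · rw [abs_mul, abs_of_nonneg (by positivity)]
    gcongr
    exact abs_softSlopeFD_le hε t y

theorem integrable_softSlope_sq {γ : Measure ℝ} [IsFiniteMeasure γ] (t : ℝ) :
    Integrable (fun y => softSlope y t ^ 2) γ :=
  Integrable.of_bound (by fun_prop) 1 (ae_of_all _ fun y => by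
    simpa using softSlope_sq_le_one y t)

theorem integral_softSugar {v : ℝ≥0} (hv : v ≠ 0) (μ σ : ℝ) {ε t : ℝ} (hε : 0 < ε) (ht : 0 < t) :
    ∫ y, softSugar σ ε t y ∂(gaussianReal μ v) =
      2 * t * gaussianTail μ v t + 2 * σ ^ 2 * ∫ y, softSlopeFD ε t y ∂(gaussianReal μ v) := by
  unfold softSugar
  rw [integral_add ((integrable_softSlope_sq t).const_mul _)
    ((integrable_softSlopeFD hε t).const_mul _), integral_const_mul, integral_const_mul,
    integral_softSlope_sq hv μ ht]

theorem softSugar_sq_le {σ ε t : ℝ} (ht : 0 < t) (y : ℝ) :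
    softSugar σ ε t y ^ 2 ≤ 8 * t ^ 2 + 8 * σ ^ 4 * softSlopeFD ε t y ^ 2 := by
  have h1 : (2 * t * softSlope y t ^ 2) ^ 2 ≤ (2 * t) ^ 2 := by
    have := softSlope_sq_le_one y t
    exact pow_le_pow_left₀ (by positivity) (mul_le_of_le_one_right (by positivity) this) 2
  -- From (a + b)² ≤ 2(a² + b²), with a² ≤ 4t² and b² = 4σ⁴ times the squared finite difference;
  -- hence both factors 8.
  have h2 := add_sq_le (a := 2 * t * softSlope y t ^ 2) (b := 2 * σ ^ 2 * softSlopeFD ε t y)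
  rw [softSugar]
  nlinarith

theorem integrable_softSlopeFD_sq {γ : Measure ℝ} [IsFiniteMeasure γ] {ε : ℝ} (hε : 0 < ε)
    (t : ℝ) : Integrable (fun y => softSlopeFD ε t y ^ 2) γ :=
  (MemLp.of_bound (by fun_prop) (2 / ε)
    (ae_of_all _ fun y => abs_softSlopeFD_le hε t y)).integrable_sq

theorem integral_softSugar_sq_le {μ : ℝ} {v : ℝ≥0} {σ ε t : ℝ} (hε : 0 < ε) (ht : 0 < t) :
    ∫ y, softSugar σ ε t y ^ 2 ∂(gaussianReal μ v) ≤
      8 * t ^ 2 + 8 * σ ^ 4 * ∫ y, softSlopeFD ε t y ^ 2 ∂(gaussianReal μ v) := by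
  have hi := (integrable_softSlopeFD_sq (γ := gaussianReal μ v) hε t).const_mul (8 * σ ^ 4)
  refine (integral_mono_of_nonneg (ae_of_all _ fun y => sq_nonneg _)
    ((integrable_const (8 * t ^ 2)).add hi) (ae_of_all _ fun y => softSugar_sq_le ht y)).trans_eq ?_
  simp only [Pi.add_apply]
  rw [integral_add (integrable_const _) hi, integral_const, probReal_univ, one_smul,
    integral_const_mul]

/-! ### Consistency -/

theorem theorem2 {Ω : Type*} [MeasurableSpace Ω] (Pr : Measure Ω) [IsProbabilityMeasure Pr]
    {N : ℕ} (z₀ : Fin N → ℝ) (Ψ : (P : ℕ) → Matrix (Fin P) (Fin N) ℝ)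
    (hΨ : ∀ P : ℕ, 1 < P → ∃ k : Fin (P + 1), Ψ P = (Ψ (P + 1)).submatrix k.succAbove id)
    (σ : ℝ) (hσ : 0 < σ)
    (W : (P : ℕ) → Ω → EuclideanSpace ℝ (Fin P))
    (hW : ∀ P : ℕ, 1 ≤ P → HasLaw (W P) (noiseLaw P σ) Pr)
    (Y : (P : ℕ) → Ω → EuclideanSpace ℝ (Fin P))
    (hY : ∀ (P : ℕ) (ω : Ω), Y P ω = meanObs Ψ z₀ P + W P ω)
    (ε : ℕ → ℝ) (hε : ∀ P : ℕ, 1 ≤ P → 0 < ε P)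
    (hε_lim : Tendsto ε atTop (𝓝 0))
    (hPε_lim : Tendsto (fun P : ℕ => (P : ℝ)⁻¹ * (ε P)⁻¹) atTop (𝓝 0))
    (lam : ℝ) (hlam : 0 < lam) :
    -- almost surely, `lam` avoids all exceptional values,
    (∀ᵐ ω ∂Pr, ∀ P : ℕ, 1 ≤ P → ∀ i : Fin P,
      lam ≠ |Y P ω i| ∧ lam ≠ |Y P ω i + ε P|) ∧
    -- and where it avoids them, it is a Lebesgue point of the weak gradients of the estimators;
    (∀ (ω : Ω) (P : ℕ), 1 ≤ P →
      (∀ i : Fin P, lam ≠ |Y P ω i| ∧ lam ≠ |Y P ω i + ε P|) →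
        HasWeakGradAt (fun t => sureFD softThreshold σ (Y P ω) t (ε P)) lam
          (sugarFD softThreshold σ (Y P ω) lam (ε P)) ∧
        HasWeakGradAt (fun t => dofFD softThreshold (Y P ω) t (ε P)) lam
          (weakGrad (fun t => dofFD softThreshold (Y P ω) t (ε P)) lam)) ∧
    -- the same holds for the risk and the degrees of freedom at every `lam > 0`;
    (∀ P : ℕ, 1 ≤ P →
      HasWeakGradAt (risk softThreshold σ (meanObs Ψ z₀ P)) lam
        (weakGrad (risk softThreshold σ (meanObs Ψ z₀ P)) lam) ∧
      HasWeakGradAt (dof softThreshold σ (meanObs Ψ z₀ P)) lam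
        (weakGrad (dof softThreshold σ (meanObs Ψ z₀ P)) lam)) ∧
    -- and both normalized errors converge to `0` in probability.
    TendstoInMeasure Pr
      (fun (P : ℕ) (ω : Ω) => 1 / (P : ℝ) *
        (sugarFD softThreshold σ (Y P ω) lam (ε P)
          - weakGrad (risk softThreshold σ (meanObs Ψ z₀ P)) lam))
      atTop (fun _ => 0) ∧
    TendstoInMeasure Pr
      (fun (P : ℕ) (ω : Ω) => 1 / (P : ℝ) *
        (weakGrad (fun t => dofFD softThreshold (Y P ω) t (ε P)) lam
          - weakGrad (dof softThreshold σ (meanObs Ψ z₀ P)) lam))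
      atTop (fun _ => 0) := by
  have hv : (σ ^ 2).toNNReal ≠ 0 := (Real.toNNReal_pos.2 (by positivity)).ne'
  have hae : ∀ᵐ ω ∂Pr, ∀ P : ℕ, 1 ≤ P → ∀ i : Fin P,
      lam ≠ |Y P ω i| ∧ lam ≠ |Y P ω i + ε P| := by
    rw [ae_all_iff]
    intro P
    rw [eventually_imp_distrib_left]
    intro hP
    rw [ae_all_iff]
    intro i
    have hlaw : HasLaw (fun ω => Y P ω i)
        (gaussianReal (meanObs Ψ z₀ P i) (σ ^ 2).toNNReal) Pr := by
      simp_rw [hY]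
      exact (hasLaw_add_noise σ (meanObs Ψ z₀ P) i).fun_comp (hW P hP)
    have h := ae_ne_abs_gaussianReal hv (meanObs Ψ z₀ P i) lam (ε P)
    rw [← hlaw.map_eq] at h
    exact ae_of_ae_map hlaw.aemeasurable h
  obtain ⟨L, hL, hbias⟩ := exists_abs_integral_softSlopeFD_sub_le hv hlam
  obtain ⟨K, hK, hsecond⟩ := exists_integral_softSlopeFD_sq_le hv hlam
  -- The variance bound of the average is a/P + cK/(Pε), which is where Pε → ∞ is used; ε → 0 serves
  -- only the bias.
  have hKlim : ∀ a c : ℝ, Tendsto (fun P : ℕ => (a + c * (K / ε P)) / P) atTop (𝓝 0) := by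
    intro a c
    have h1 := (tendsto_const_div_atTop_nhds_zero_nat a).add (hPε_lim.const_mul (c * K))
    rw [mul_zero, add_zero] at h1
    refine h1.congr fun P => ?_
    simp only [div_eq_mul_inv]
    ring
  have hLlim : ∀ c : ℝ, Tendsto (fun P => c * (L * ε P)) atTop (𝓝 0) := fun c => by
    simpa using (hε_lim.const_mul L).const_mul c
  refine ⟨hae, fun ω P _ hy => ⟨?_, ?_⟩, fun P _ => ⟨?_, ?_⟩, ?_, ?_⟩
  · exact (hasWeakGradAt_sureFD_softThreshold σ hlam hy).hasWeakGradAt_weakGrad hlam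
  · exact (hasWeakGradAt_dofFD_softThreshold hlam hy).hasWeakGradAt_weakGrad hlam
  · exact (hasWeakGradAt_risk_softThreshold hσ _ lam).hasWeakGradAt_weakGrad hlam
  · exact (hasWeakGradAt_dof_softThreshold hσ _ lam).hasWeakGradAt_weakGrad hlam
  · have h := tendstoInMeasure_average_sub hW (meanObs Ψ z₀)
      (f := fun P => softSugar σ (ε P) lam)
      (m := fun _ μ => 2 * lam * gaussianTail μ (σ ^ 2).toNNReal lam +
        2 * σ ^ 2 * gaussianTailDeriv μ (σ ^ 2).toNNReal lam)
      (V := fun P => 8 * lam ^ 2 + 8 * σ ^ 4 * (K / ε P)) (b := fun P => 2 * σ ^ 2 * (L * ε P))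
      (fun P => measurable_softSugar σ (ε P) lam) (fun P hP => abs_softSugar_le (hε P hP) hlam)
      (fun P hP μ => (integral_softSugar_sq_le (hε P hP) hlam).trans (by
        gcongr
        exact hsecond μ (ε P) (hε P hP)))
      (fun P hP μ => by
        rw [integral_softSugar hv μ σ (hε P hP) hlam, add_sub_add_left_eq_sub, ← mul_sub, abs_mul,
          abs_of_nonneg (by positivity)]
        gcongr
        exact hbias μ (ε P) (hε P hP))
      (hKlim _ _) (hLlim _)
    -- The weak gradients have their explicit values only where `lam` avoids the exceptional set,
    -- which is enough since convergence in measure ignores null sets.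
    refine h.congr' ?_ EventuallyEq.rfl
    filter_upwards [eventually_ge_atTop 1] with P hP
    filter_upwards [hae] with ω hω
    rw [sugarFD, (hasWeakGradAt_sureFD_softThreshold σ hlam (hω P hP)).weakGrad_eq hlam,
      (hasWeakGradAt_risk_softThreshold hσ (meanObs Ψ z₀ P) lam).weakGrad_eq hlam, hY]
  · have h := tendstoInMeasure_average_sub hW (meanObs Ψ z₀)
      (f := fun P => softSlopeFD (ε P) lam)
      (m := fun _ μ => gaussianTailDeriv μ (σ ^ 2).toNNReal lam)
      (V := fun P => 0 + 1 * (K / ε P)) (b := fun P => 1 * (L * ε P))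
      (fun P => measurable_softSlopeFD (ε P) lam)
      (fun P hP => abs_softSlopeFD_le (hε P hP) lam)
      (fun P hP μ => by simpa using hsecond μ (ε P) (hε P hP))
      (fun P hP μ => by simpa using hbias μ (ε P) (hε P hP))
      (hKlim _ _) (hLlim _)
    refine h.congr' ?_ EventuallyEq.rfl
    filter_upwards [eventually_ge_atTop 1] with P hP
    filter_upwards [hae] with ω hω
    rw [(hasWeakGradAt_dofFD_softThreshold hlam (hω P hP)).weakGrad_eq hlam,
      (hasWeakGradAt_dof_softThreshold hσ (meanObs Ψ z₀ P) lam).weakGrad_eq hlam, hY]
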